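/- Let $m,n$ be non-negative integers, $\lambda>0$, and let $\alpha_1,\dots,\alpha_n$ be linear forms on $\mathbb R^m$. For $z,w\in\mathbb C^n$ write $zw=\sum_k z_kw_k$, $|z|^2=\sum_k|z_k|^2$ and $\omega((z,w),(z',w'))=\tfrac i2(zw'-z'w)$, and let $\mathbb R^m$ act on $\mathbb C^n$ by $t\cdot z=(e^{i\alpha_1(t)}z_1,\dots,e^{i\alpha_n(t)}z_n)$; we write $t^{-1}\cdot z$ for $(-t)\cdot z$. Let $G=\mathbb R^m\times\mathbb C^n\times\mathbb R$ be the generalized diamond group, with multiplication $$(t,z,c)(t',z',c')=\bigl(t+t',\,z+t\cdot z',\,c+c'+\tfrac12\,\omega((z,\bar z),(t\cdot z',\overline{t\cdot z'}))\bigr),$$ let $\mathfrak g=\mathbb R^m\times\mathbb C^n\times\mathbb R$ be its Lie algebra (the tangent space at the identity), and let $\exp:\mathfrak g\to G$ be its exponential map, i.e. $\exp(X)=\gamma(1)$ for the one-parameter subgroup $\gamma$ of $G$ with $\gamma'(0)=X$. Let $\mathcal F_\lambda$ be the Fock space of holomorphic functions $f$ on $\mathbb C^n$ with $\int|f(z)|^2e^{-\lambda|z|^2/2}\,d\mu_\lambda(z)<\infty$,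 where $d\mu_\lambda=(2\pi)^{-n}\lambda^n\,dm$ and $dm$ is Lebesgue measure, with inner product $\langle f,g\rangle=\int f\bar g\,e^{-\lambda|z|^2/2}\,d\mu_\lambda$ and coherent states $e_z(w)=\exp(\lambda\bar zw/2)$. Let $\chi:\mathbb R^m\to\{\zeta\in\mathbb C:|\zeta|=1\}$ be a unitary character and let $\pi$ be the representation of $G$ on $\mathcal F_\lambda$ given by $$(\pi(t,z_0,c_0)f)(z)=\chi(t)\exp\bigl(i\lambda c_0+\tfrac\lambda2\bar z_0z-\tfrac\lambda4|z_0|^2\bigr)f(t^{-1}\cdot(z-z_0)).$$ For an operator $A$ on $\mathcal F_\lambda$ with kernel $k_A(z,w)=\langle Ae_w,e_z\rangle$, the complex Weyl symbol of $A$ is $$W_0(A)(z)=2^n\int_{\mathbb C^n}k_A(z+w,z-w)\exp\bigl(\tfrac\lambda2(-z\bar z-w\bar w+z\bar w-\bar zw)\bigr)\,d\mu_\lambda(w),$$ whenever this integral converges absolutely. Let $X=(t,u,c)\in\mathfrak g$ be such that $\alpha_k(t)\notin\pi+2\pi\mathbb Z$ for $k=1,\dots,n$. Then for every $z\in\mathbb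 C^n$ the integral defining $W_0(\pi(\exp X))(z)$ converges absolutely, and \begin{align*} W_0(\pi(\exp X))(z)={}&2^n\chi(t)e^{i\lambda c}\prod_{k=1}^n(1+e^{-i\alpha_k(t)})^{-1}\\ &\times\exp\Bigl(i\tfrac\lambda2\sum_{k=1}^n|u_k|^2\,\frac{\alpha_k(t)-2\tan(\frac12\alpha_k(t))}{\alpha_k(t)^2}\Bigr)\\ &\times\exp\Bigl(-i\lambda\sum_{k=1}^n|z_k|^2\tan(\tfrac12\alpha_k(t))\Bigr)\\ &\times\exp\Bigl(\lambda\sum_{k=1}^n\frac{\tan(\frac12\alpha_k(t))}{\alpha_k(t)}\,(z_k\bar u_k-\bar z_ku_k)\Bigr), \end{align*} where, if $\alpha_k(t)=0$, the quotients $\frac{\alpha_k(t)-2\tan(\alpha_k(t)/2)}{\alpha_k(t)^2}$ and $\frac{\tan(\alpha_k(t)/2)}{\alpha_k(t)}$ are replaced by their limits $0$ and $\frac12$. -/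

import Mathlib

noncomputable section

open MeasureTheory
open scoped ComplexConjugate

namespace Diamond

/-! ### The generalized diamond group -/

/-- The bilinear pairing `zw = ∑ₖ zₖ wₖ` on `ℂⁿ`. -/
def pair {n : ℕ} (z w : Fin n → ℂ) : ℂ := ∑ k, z k * w k

/-- Componentwise complex conjugation on `ℂⁿ`. -/
def cbar {n : ℕ} (z : Fin n → ℂ) : Fin n → ℂ := fun k => conj (z k)

/-- `|z|² = ∑ₖ |zₖ|²`. -/
def absSq {n : ℕ} (z : Fin n → ℂ) : ℝ := ∑ k, ‖z k‖ ^ 2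

/-- `ω((z,w),(z',w')) = (i/2)(zw' - z'w)`. -/
def omega {n : ℕ} (p q : (Fin n → ℂ) × (Fin n → ℂ)) : ℂ :=
  Complex.I / 2 * (pair p.1 q.2 - pair q.1 p.2)

/-- The real number `ω((z, z̄), (z', z̄'))`; see `omegaR_eq`. -/
def omegaR {n : ℕ} (z z' : Fin n → ℂ) : ℝ := (omega (z, cbar z) (z', cbar z')).re

theorem omegaR_sum {n : ℕ} (z z' : Fin n → ℂ) :
    omegaR z z' = ∑ k, ((z k).re * (z' k).im - (z k).im * (z' k).re) := by
  simp only [omegaR, omega, pair, cbar, ← Finset.sum_sub_distrib, Finset.mul_sum, Complex.re_sum]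
  refine Finset.sum_congr rfl fun k _ => ?_
  simp [Complex.mul_re, Complex.mul_im]
  ring

theorem omegaR_eq {n : ℕ} (z z' : Fin n → ℂ) :
    (omegaR z z' : ℂ) = omega (z, cbar z) (z', cbar z') := by
  refine Complex.ext (by simp [omegaR]) ?_
  simp only [omega, pair, cbar, ← Finset.sum_sub_distrib, Finset.mul_sum, Complex.im_sum,
    Complex.ofReal_im]
  refine (Finset.sum_eq_zero fun k _ => ?_).symm
  simp [Complex.mul_re, Complex.mul_im]
  ring

variable {m n : ℕ}

/-- The action `t · z = (e^{iα₁(t)} z₁, …, e^{iαₙ(t)} zₙ)` of `ℝᵐ` on `ℂⁿ`. -/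
def act (α : Fin n → ((Fin m → ℝ) →ₗ[ℝ] ℝ)) (t : Fin m → ℝ) (z : Fin n → ℂ) : Fin n → ℂ :=
  fun k => Complex.exp (Complex.I * (α k t : ℂ)) * z k

/-- The generalized diamond group `G = ℝᵐ ⋊ Hₙ` of the linear forms `α₁, …, αₙ`. -/
@[ext]
structure DGroup (α : Fin n → ((Fin m → ℝ) →ₗ[ℝ] ℝ)) where
  t : Fin m → ℝ
  z : Fin n → ℂ
  c : ℝ

variable {α : Fin n → ((Fin m → ℝ) →ₗ[ℝ] ℝ)}

theorem act_add (s t : Fin m → ℝ) (z : Fin n → ℂ) :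
    act α (s + t) z = act α s (act α t z) := by
  funext k
  simp [act, mul_add, Complex.exp_add, mul_assoc]

theorem act_zero (z : Fin n → ℂ) : act α 0 z = z := by
  funext k
  simp [act]

theorem act_neg_self (t : Fin m → ℝ) (z : Fin n → ℂ) : act α (-t) (act α t z) = z := by
  rw [← act_add, neg_add_cancel, act_zero]

theorem act_vadd (t : Fin m → ℝ) (z w : Fin n → ℂ) :
    act α t (z + w) = act α t z + act α t w := by
  funext k
  simp [act, mul_add]

theorem act_vneg (t : Fin m → ℝ) (z : Fin n → ℂ) : act α t (-z) = -act α t z := by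
  funext k
  simp [act]

theorem omegaR_add_left (x y z : Fin n → ℂ) : omegaR (x + y) z = omegaR x z + omegaR y z := by
  simp only [omegaR_sum, ← Finset.sum_add_distrib]
  refine Finset.sum_congr rfl fun k _ => ?_
  simp
  ring

theorem omegaR_add_right (x y z : Fin n → ℂ) : omegaR x (y + z) = omegaR x y + omegaR x z := by
  simp only [omegaR_sum, ← Finset.sum_add_distrib]
  refine Finset.sum_congr rfl fun k _ => ?_
  simp
  ring

theorem omegaR_neg_self (x : Fin n → ℂ) : omegaR (-x) x = 0 := by
  simp only [omegaR_sum]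
  refine Finset.sum_eq_zero fun k _ => ?_
  simp
  ring

theorem omegaR_zero_left (x : Fin n → ℂ) : omegaR 0 x = 0 := by
  simp [omegaR_sum]

theorem omegaR_zero_right (x : Fin n → ℂ) : omegaR x 0 = 0 := by
  simp [omegaR_sum]

theorem omegaR_act (t : Fin m → ℝ) (x y : Fin n → ℂ) :
    omegaR (act α t x) (act α t y) = omegaR x y := by
  simp only [omegaR_sum]
  refine Finset.sum_congr rfl fun k _ => ?_
  have h := Real.sin_sq_add_cos_sq (α k t)
  simp only [act, mul_comm Complex.I, Complex.exp_mul_I, ← Complex.ofReal_cos,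
    ← Complex.ofReal_sin, Complex.mul_re, Complex.mul_im, Complex.add_re, Complex.add_im,
    Complex.ofReal_re, Complex.ofReal_im, Complex.I_re, Complex.I_im]
  linear_combination ((x k).re * (y k).im - (x k).im * (y k).re) * h

/-- The group law
`(t,z,c)(t',z',c') = (t+t', z + t·z', c + c' + ½ ω((z, z̄), (t·z', conj (t·z'))))`. -/
instance : Mul (DGroup α) :=
  ⟨fun g h => ⟨g.t + h.t, g.z + act α g.t h.z, g.c + h.c + 1 / 2 * omegaR g.z (act α g.t h.z)⟩⟩

instance : One (DGroup α) := ⟨⟨0, 0, 0⟩⟩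

instance : Inv (DGroup α) := ⟨fun g => ⟨-g.t, -act α (-g.t) g.z, -g.c⟩⟩

@[simp] theorem mul_t (g h : DGroup α) : (g * h).t = g.t + h.t := rfl
@[simp] theorem mul_z (g h : DGroup α) : (g * h).z = g.z + act α g.t h.z := rfl
@[simp] theorem mul_c (g h : DGroup α) :
    (g * h).c = g.c + h.c + 1 / 2 * omegaR g.z (act α g.t h.z) := rfl
@[simp] theorem one_t : (1 : DGroup α).t = 0 := rfl
@[simp] theorem one_z : (1 : DGroup α).z = 0 := rfl
@[simp] theorem one_c : (1 : DGroup α).c = 0 := rfl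
@[simp] theorem inv_t (g : DGroup α) : (g⁻¹).t = -g.t := rfl
@[simp] theorem inv_z (g : DGroup α) : (g⁻¹).z = -act α (-g.t) g.z := rfl
@[simp] theorem inv_c (g : DGroup α) : (g⁻¹).c = -g.c := rfl

instance : Group (DGroup α) :=
  Group.ofLeftAxioms
    (fun a b c => by
      ext1
      · simp [add_assoc]
      · simp [act_add, act_vadd, add_assoc]
      · simp only [mul_c, mul_z, mul_t, act_add, act_vadd, omegaR_add_left, omegaR_add_right,
          omegaR_act]
        ring)
    (fun a => by
      ext1
      · simp
      · simp [act_zero]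
      · simp [omegaR_zero_left])
    (fun a => by
      ext1
      · simp
      · simp
      · simp [omegaR_neg_self])

/-! ### The exponential map -/

/-- `γ` is the one-parameter subgroup of `G` with initial velocity `X = (t, u, c)`, an element of
the Lie algebra `𝔤 = T₁G`, which is `ℝᵐ × ℂⁿ × ℝ` in the global coordinates of `G`. -/
def IsOneParam (γ : ℝ → DGroup α) (X : (Fin m → ℝ) × (Fin n → ℂ) × ℝ) : Prop :=
  (∀ s s' : ℝ, γ (s + s') = γ s * γ s') ∧
    HasDerivAt (fun s => ((γ s).t, (γ s).z, (γ s).c)) X 0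


theorem hasDerivAt_comp {γ : ℝ → DGroup α} {X : (Fin m → ℝ) × (Fin n → ℂ) × ℝ}
    (h : IsOneParam γ X) :
    HasDerivAt (fun s => (γ s).t) X.1 0 ∧ (∀ k, HasDerivAt (fun s => (γ s).z k) (X.2.1 k) 0) ∧
      HasDerivAt (fun s => (γ s).c) X.2.2 0 := by
  have h1 := h.2.hasFDerivAt
  refine ⟨by simpa using h1.fst.hasDerivAt, fun k => ?_, by simpa using h1.snd.snd.hasDerivAt⟩
  have h2 := hasDerivAt_pi.1 (h1.snd.fst.hasDerivAt) k
  simpa using h2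

theorem isOneParam_zero {γ : ℝ → DGroup α} {X : (Fin m → ℝ) × (Fin n → ℂ) × ℝ}
    (h : IsOneParam γ X) : γ 0 = 1 := by
  have := h.1 0 0
  simpa using this

theorem isOneParam_deriv {γ : ℝ → DGroup α} {X : (Fin m → ℝ) × (Fin n → ℂ) × ℝ}
    (h : IsOneParam γ X) (s : ℝ) :
    HasDerivAt (fun s => (γ s).t) X.1 s ∧
    (∀ k, HasDerivAt (fun s => (γ s).z k)
      (X.2.1 k + Complex.I * (α k X.1 : ℂ) * (γ s).z k) s) ∧
    HasDerivAt (fun s => (γ s).c) (X.2.2 + 1 / 2 * omegaR X.2.1 (γ s).z) s := by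
  obtain ⟨ht, hz, hc⟩ := hasDerivAt_comp h
  have h0 := isOneParam_zero h
  have e : ∀ r, γ r = γ (r - s) * γ s := fun r => by rw [← h.1]; simp
  have hα : ∀ k, HasDerivAt (fun r => α k (γ r).t) (α k X.1) 0 := fun k =>
    (LinearMap.toContinuousLinearMap (α k)).hasFDerivAt.comp_hasDerivAt (0 : ℝ) ht
  have hact : ∀ k, HasDerivAt (fun r => act α (γ r).t (γ s).z k)
      (Complex.I * (α k X.1 : ℂ) * (γ s).z k) 0 := fun k => by
    have := (((hα k).ofReal_comp.const_mul Complex.I).cexp).mul_const ((γ s).z k)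
    simpa [act, h0] using this
  refine ⟨?_, fun k => ?_, ?_⟩
  · have h1 : HasDerivAt (fun r => (γ r).t + (γ s).t) X.1 (s - s) := by
      simpa using ht.add_const (γ s).t
    refine (HasDerivAt.comp_sub_const (a := s) (x := s) (f := fun r => (γ r).t + (γ s).t)
      h1).congr_of_eventuallyEq (.of_forall fun r => ?_)
    simp [e r]
  · have h1 : HasDerivAt (fun r => (γ r).z k + act α (γ r).t (γ s).z k)
        (X.2.1 k + Complex.I * (α k X.1 : ℂ) * (γ s).z k) (s - s) := by
      simpa using (hz k).fun_add (hact k)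
    refine (HasDerivAt.comp_sub_const (a := s) (x := s) h1).congr_of_eventuallyEq
      (.of_forall fun r => ?_)
    simp only [e r, mul_z, Pi.add_apply]
  · have re' : ∀ {f : ℝ → ℂ} {f' : ℂ}, HasDerivAt f f' 0 →
        HasDerivAt (fun r => (f r).re) f'.re 0 := fun hf =>
      Complex.reCLM.hasFDerivAt.comp_hasDerivAt (0 : ℝ) hf
    have im' : ∀ {f : ℝ → ℂ} {f' : ℂ}, HasDerivAt f f' 0 →
        HasDerivAt (fun r => (f r).im) f'.im 0 := fun hf =>
      Complex.imCLM.hasFDerivAt.comp_hasDerivAt (0 : ℝ) hf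
    have hω : HasDerivAt (fun r => omegaR (γ r).z (act α (γ r).t (γ s).z))
        (omegaR X.2.1 (γ s).z) 0 := by
      simp only [omegaR_sum]
      refine HasDerivAt.fun_sum fun k _ => ?_
      have := ((re' (hz k)).fun_mul (im' (hact k))).fun_sub ((im' (hz k)).fun_mul (re' (hact k)))
      simpa [h0, act_zero] using this
    have h1 : HasDerivAt (fun r => (γ r).c + (γ s).c
        + 1 / 2 * omegaR (γ r).z (act α (γ r).t (γ s).z))
        (X.2.2 + 1 / 2 * omegaR X.2.1 (γ s).z) (s - s) := by
      rw [sub_self]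
      exact (hc.add_const (γ s).c).fun_add (hω.const_mul (1 / 2))
    refine (HasDerivAt.comp_sub_const (a := s) (x := s) h1).congr_of_eventuallyEq
      (.of_forall fun r => ?_)
    simp only [e r, mul_c]

theorem isOneParam_unique {γ δ : ℝ → DGroup α} {X : (Fin m → ℝ) × (Fin n → ℂ) × ℝ}
    (hγ : IsOneParam γ X) (hδ : IsOneParam δ X) : γ = δ := by
  have key : ∀ {E : Type} [NormedAddCommGroup E] [NormedSpace ℝ E] (f : ℝ → E),
      (∀ s, HasDerivAt f 0 s) → f 0 = 0 → ∀ s, f s = 0 := fun f hf h0 s => by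
    rw [is_const_of_deriv_eq_zero (fun s => (hf s).differentiableAt) (fun s => (hf s).deriv) s 0,
      h0]
  have hγ0 := isOneParam_zero hγ
  have hδ0 := isOneParam_zero hδ
  have hz : ∀ s, (γ s).z = (δ s).z := fun s => by
    funext k
    have h1 := key (fun s : ℝ => Complex.exp (-(Complex.I * (α k X.1 : ℂ) * (s : ℂ))) *
      ((γ s).z k - (δ s).z k)) (fun s => by
        have h2 := (((Complex.ofRealCLM.hasDerivAt (x := s)).const_mul
          (Complex.I * (α k X.1 : ℂ))).fun_neg.cexp).fun_mul
          (((isOneParam_deriv hγ s).2.1 k).fun_sub ((isOneParam_deriv hδ s).2.1 k))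
        refine h2.congr_deriv ?_
        simp
        ring) (by simp [hγ0, hδ0]) s
    simpa [sub_eq_zero] using h1
  funext s
  ext1
  · have h1 := key (fun s => (γ s).t - (δ s).t)
      (fun s => by simpa using (isOneParam_deriv hγ s).1.fun_sub (isOneParam_deriv hδ s).1)
      (by simp [hγ0, hδ0]) s
    exact sub_eq_zero.1 h1
  · exact hz s
  · have h1 := key (fun s => (γ s).c - (δ s).c)
      (fun s => by
        simpa [hz] using (isOneParam_deriv hγ s).2.2.fun_sub (isOneParam_deriv hδ s).2.2)
      (by simp [hγ0, hδ0]) s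
    exact sub_eq_zero.1 h1

theorem exists_isOneParam (α : Fin n → ((Fin m → ℝ) →ₗ[ℝ] ℝ))
    (X : (Fin m → ℝ) × (Fin n → ℂ) × ℝ) :
    ∃ γ : ℝ → DGroup α, IsOneParam γ X := by
  obtain ⟨t, u, c⟩ := X
  let ζ : ℝ → ℝ → ℂ := fun a s =>
    if a = 0 then (s : ℂ) else (Complex.exp (Complex.I * (a * s : ℝ)) - 1) / (Complex.I * a)
  let κ : ℝ → ℝ → ℝ := fun a s => if a = 0 then 0 else 1 / 2 * ((a * s - Real.sin (a * s)) / a ^ 2)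
  refine ⟨fun s => ⟨s • t, fun k => ζ (α k t) s * u k, s * c + ∑ k, ‖u k‖ ^ 2 * κ (α k t) s⟩,
    fun s s' => ?_, ?_⟩
  · ext1
    · simp [add_smul]
    · funext k
      by_cases ha : α k t = 0
      · simp [ζ, act, ha, add_mul]
      · have : (α k t : ℂ) ≠ 0 := by exact_mod_cast ha
        simp [ζ, act, ha, mul_add, Complex.exp_add]
        field_simp
        ring_nf
    · simp only [mul_c, omegaR_sum, act, map_smul, smul_eq_mul, Finset.mul_sum]
      have hk : ∀ k, ‖u k‖ ^ 2 * κ (α k t) (s + s') = ‖u k‖ ^ 2 * κ (α k t) s +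
          ‖u k‖ ^ 2 * κ (α k t) s' + 1 / 2 * ((ζ (α k t) s * u k).re *
          (Complex.exp (Complex.I * ((s * α k t : ℝ) : ℂ)) * (ζ (α k t) s' * u k)).im -
          (ζ (α k t) s * u k).im *
          (Complex.exp (Complex.I * ((s * α k t : ℝ) : ℂ)) * (ζ (α k t) s' * u k)).re) := by
        intro k
        rw [← Complex.normSq_eq_norm_sq, Complex.normSq_apply, mul_comm s]
        generalize α k t = a
        by_cases ha : a = 0
        · simp [ζ, κ, ha]
          ring
        · have hz : ∀ r : ℝ, ζ a r = ⟨Real.sin (a * r) / a, (1 - Real.cos (a * r)) / a⟩ := by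
            intro r
            have : (a : ℂ) ≠ 0 := by exact_mod_cast ha
            simp only [ζ, if_neg ha]
            rw [div_eq_iff (by simp [this]), mul_comm Complex.I, Complex.exp_mul_I,
              ← Complex.ofReal_cos, ← Complex.ofReal_sin]
            refine Complex.ext ?_ ?_ <;>
              simp [-Complex.ofReal_cos, -Complex.ofReal_sin, -Complex.ofReal_mul] <;>
              field_simp <;> ring
          simp only [hz, κ, if_neg ha, mul_comm Complex.I, Complex.exp_mul_I,
            ← Complex.ofReal_cos, ← Complex.ofReal_sin, Complex.mul_re, Complex.mul_im,
            Complex.add_re, Complex.add_im, Complex.ofReal_re, Complex.ofReal_im, Complex.I_re,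
            Complex.I_im, mul_add, Real.sin_add]
          have h1 := Real.sin_sq_add_cos_sq (a * s)
          field_simp
          linear_combination (-((u k).re ^ 2 + (u k).im ^ 2) * Real.sin (a * s')) * h1
      rw [Finset.sum_congr rfl fun k _ => hk k, Finset.sum_add_distrib, Finset.sum_add_distrib]
      ring
  · have hζ : ∀ a, HasDerivAt (ζ a) 1 0 := fun a => by
      by_cases ha : a = 0
      · simp only [ζ, ha, if_true]
        exact Complex.ofRealCLM.hasDerivAt (x := (0 : ℝ))
      · have ha' : (a : ℂ) ≠ 0 := by exact_mod_cast ha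
        have h1 := ((((((hasDerivAt_id (0 : ℝ)).const_mul a).ofReal_comp).const_mul
          Complex.I).cexp).sub_const 1).div_const (Complex.I * a)
        simp only [ζ, ha, if_false]
        refine h1.congr_deriv ?_
        simp [ha']
    have hκ : ∀ a, HasDerivAt (κ a) 0 0 := fun a => by
      by_cases ha : a = 0
      · simp only [κ, ha, if_true]
        exact hasDerivAt_const _ _
      · have h0 := (hasDerivAt_id (0 : ℝ)).const_mul a
        have h1 := ((h0.fun_sub h0.sin).div_const (a ^ 2)).const_mul (1 / 2)
        simp only [κ, ha, if_false]
        refine h1.congr_deriv ?_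
        simp
    refine HasDerivAt.prodMk ?_ (HasDerivAt.prodMk ?_ ?_)
    · simpa using (hasDerivAt_id (0 : ℝ)).smul_const t
    · exact hasDerivAt_pi.2 fun k => by simpa using (hζ (α k t)).mul_const (u k)
    · have h1 := ((hasDerivAt_id (0 : ℝ)).mul_const c).fun_add
        (HasDerivAt.fun_sum (u := Finset.univ) fun k _ => (hκ (α k t)).const_mul (‖u k‖ ^ 2))
      simpa using h1

/-- Every `X ∈ 𝔤` generates exactly one one-parameter subgroup of `G`. -/
theorem existsUnique_isOneParam (α : Fin n → ((Fin m → ℝ) →ₗ[ℝ] ℝ))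
    (X : (Fin m → ℝ) × (Fin n → ℂ) × ℝ) :
    ∃! γ : ℝ → DGroup α, IsOneParam γ X := by
  obtain ⟨γ, hγ⟩ := exists_isOneParam α X
  exact ⟨γ, hγ, fun δ hδ => isOneParam_unique hδ hγ⟩

/-- The exponential map of `G`: the value at time `1` of the one-parameter subgroup generated
by `X`. -/
def expG (α : Fin n → ((Fin m → ℝ) →ₗ[ℝ] ℝ)) (X : (Fin m → ℝ) × (Fin n → ℂ) × ℝ) : DGroup α :=
  (existsUnique_isOneParam α X).choose 1

/-! ### The Fock space and the representation -/

/-- The measure `dμ_λ = (2π)⁻ⁿ λⁿ dm` on `ℂⁿ`, where `dm` is Lebesgue measure. -/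
def fockMeasure (n : ℕ) (lam : ℝ) : Measure (Fin n → ℂ) :=
  ENNReal.ofReal ((2 * Real.pi)⁻¹ ^ n * lam ^ n) • volume

/-- The Fock space `𝓕_λ`: all holomorphic `f` on `ℂⁿ` with `∫ |f|² e^{-λ|z|²/2} dμ_λ < ∞`. -/
def Fock (n : ℕ) (lam : ℝ) : Submodule ℂ ((Fin n → ℂ) → ℂ) where
  carrier := {f | Differentiable ℂ f ∧
    Integrable (fun z => ‖f z‖ ^ 2 * Real.exp (-lam * absSq z / 2)) (fockMeasure n lam)}
  zero_mem' := ⟨differentiable_const _, by simp⟩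
  add_mem' := by
    rintro f g ⟨hf, hf'⟩ ⟨hg, hg'⟩
    refine ⟨hf.add hg, ((hf'.const_mul 2).add (hg'.const_mul 2)).mono' ?_ (.of_forall fun z => ?_)⟩
    · refine Continuous.aestronglyMeasurable ?_
      have h1 := hf.continuous
      have h2 := hg.continuous
      simp only [absSq]
      fun_prop
    · rw [Real.norm_of_nonneg (by positivity)]
      have h1 : ‖f z + g z‖ ^ 2 ≤ 2 * ‖f z‖ ^ 2 + 2 * ‖g z‖ ^ 2 := by
        have := norm_add_le (f z) (g z)
        nlinarith [sq_nonneg (‖f z‖ - ‖g z‖), norm_nonneg (f z + g z)]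
      have h2 := mul_le_mul_of_nonneg_right h1 (Real.exp_nonneg (-lam * absSq z / 2))
      simp only [Pi.add_apply]
      linarith
  smul_mem' := by
    rintro a f ⟨hf, hf'⟩
    refine ⟨hf.const_smul a, (hf'.const_mul (‖a‖ ^ 2)).congr (.of_forall fun z => ?_)⟩
    simp [mul_pow, mul_assoc]

/-- The inner product `⟨f, g⟩ = ∫ f ḡ e^{-λ|z|²/2} dμ_λ`, linear in the first variable. -/
def fockInner {n : ℕ} {lam : ℝ} (f g : Fock n lam) : ℂ :=
  ∫ z, (f : (Fin n → ℂ) → ℂ) z * conj ((g : (Fin n → ℂ) → ℂ) z) *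
    (Real.exp (-lam * absSq z / 2) : ℂ) ∂(fockMeasure n lam)

/-- The coherent state `e_z(w) = exp(λ z̄ w / 2)`. -/
def cohFun (lam : ℝ) (z : Fin n → ℂ) : (Fin n → ℂ) → ℂ :=
  fun w => Complex.exp (lam * pair (cbar z) w / 2)

theorem cohFun_mem {lam : ℝ} (hlam : 0 < lam) (z : Fin n → ℂ) : cohFun lam z ∈ Fock n lam := by
  refine ⟨?_, ?_⟩
  · unfold cohFun pair
    fun_prop
  · refine Integrable.smul_measure ?_ ENNReal.ofReal_ne_top
    have h1 : ∀ k, Integrable (fun w : ℂ =>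
        ‖Complex.exp (-((lam / 2 : ℝ) : ℂ) * ‖w‖ ^ 2 + (lam : ℂ) * (inner ℝ (z k) w : ℝ))‖) :=
      fun k => (GaussianFourier.integrable_cexp_neg_mul_sq_norm_add
        (by simpa using hlam) (lam : ℂ) (z k)).norm
    refine (Integrable.fintype_prod h1).congr (.of_forall fun w => ?_)
    simp only [Complex.norm_exp, cohFun, pow_two, ← Real.exp_add, ← Real.exp_sum, absSq, pair, cbar]
    congr 1
    have h2 : ((lam : ℂ) * (∑ k, conj (z k) * w k) / 2).re
        = lam / 2 * ∑ k, (conj (z k) * w k).re := by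
      rw [← Complex.re_sum, ← Complex.re_ofReal_mul]
      congr 1
      push_cast
      ring
    have h3 : ∀ k, (-((lam / 2 : ℝ) : ℂ) * ((‖w k‖ : ℂ) * ‖w k‖)
        + (lam : ℂ) * (inner ℝ (z k) (w k) : ℝ)).re
        = lam * (conj (z k) * w k).re + (-lam / 2) * (‖w k‖ * ‖w k‖) := by
      intro k
      simp [Complex.inner, Complex.mul_re]
      ring
    rw [h2, Finset.sum_congr rfl fun k _ => h3 k, Finset.sum_add_distrib, ← Finset.mul_sum,
      ← Finset.mul_sum]
    ring

/-- The coherent state `e_z` as an element of the Fock space. -/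
def coh {lam : ℝ} (hlam : 0 < lam) (z : Fin n → ℂ) : Fock n lam :=
  ⟨cohFun lam z, cohFun_mem hlam z⟩

/-- `(π(t,z₀,c₀)f)(z) = χ(t) exp(iλc₀ + (λ/2) z̄₀ z - (λ/4)|z₀|²) f(t⁻¹·(z - z₀))`. -/
def piFun (lam : ℝ) (χ : AddChar (Fin m → ℝ) Circle) (g : DGroup α) (f : (Fin n → ℂ) → ℂ) :
    (Fin n → ℂ) → ℂ :=
  fun z => (χ g.t : ℂ) * Complex.exp (Complex.I * lam * g.c + lam / 2 * pair (cbar g.z) z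
    - lam / 4 * absSq g.z) * f (act α (-g.t) (z - g.z))

theorem absSq_eq (z : Fin n → ℂ) : absSq z = ∑ k, ((z k).re * (z k).re + (z k).im * (z k).im) := by
  simp only [absSq, ← Complex.normSq_eq_norm_sq, Complex.normSq_apply]

theorem absSq_act (t : Fin m → ℝ) (z : Fin n → ℂ) : absSq (act α t z) = absSq z := by
  simp [absSq, act, mul_comm Complex.I, Complex.norm_exp_ofReal_mul_I]

theorem measurePreserving_act (t : Fin m → ℝ) : MeasurePreserving (act α t) := by
  refine volume_preserving_pi (α' := fun _ : Fin n => ℂ) (β' := fun _ : Fin n => ℂ)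
    (f := fun k w => Complex.exp (Complex.I * (α k t : ℂ)) * w) fun k => ?_
  have e : (fun w => Complex.exp (Complex.I * (α k t : ℂ)) * w)
      = rotation (Circle.exp (α k t)) := by
    funext w
    rw [rotation_apply, Circle.coe_exp, mul_comm Complex.I]
  rw [e]
  exact (rotation (Circle.exp (α k t))).measurePreserving

theorem piFun_mem {lam : ℝ} (χ : AddChar (Fin m → ℝ) Circle) (g : DGroup α)
    {f : (Fin n → ℂ) → ℂ} (hf : f ∈ Fock n lam) : piFun lam χ g f ∈ Fock n lam := by
  obtain ⟨hd, hi⟩ := hf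
  have hact : Differentiable ℂ (fun z : Fin n → ℂ => act α (-g.t) (z - g.z)) := by
    unfold act
    fun_prop
  have hd' : Differentiable ℂ (piFun lam χ g f) := by
    unfold piFun pair
    have := hd.comp hact
    simp only [Function.comp_def] at this
    fun_prop
  refine ⟨hd', ?_⟩
  by_cases h0 : ENNReal.ofReal ((2 * Real.pi)⁻¹ ^ n * lam ^ n) = 0
  · rw [fockMeasure, h0, zero_smul]
    exact integrable_zero_measure
  unfold fockMeasure at hi ⊢
  rw [integrable_smul_measure h0 ENNReal.ofReal_ne_top] at hi ⊢
  have h1 := ((measurePreserving_act (α := α) (-g.t)).comp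
    (measurePreserving_sub_right (volume : Measure (Fin n → ℂ)) g.z)).integrable_comp_of_integrable hi
  refine h1.congr (.of_forall fun z => ?_)
  simp only [Function.comp, piFun, absSq_act, norm_mul, Circle.norm_coe, one_mul, mul_pow,
    Complex.norm_exp]
  rw [mul_comm, mul_right_comm]
  congr 1
  rw [pow_two, ← Real.exp_add, ← Real.exp_add]
  congr 1
  have h2 : (Complex.I * lam * g.c + lam / 2 * pair (cbar g.z) z - lam / 4 * absSq g.z : ℂ).re
      = lam / 2 * ∑ k, (conj (g.z k) * z k).re - lam / 4 * absSq g.z := by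
    rw [← Complex.re_sum, ← Complex.re_ofReal_mul]
    have : (lam / 4 * absSq g.z : ℂ) = ((lam / 4 * absSq g.z : ℝ) : ℂ) := by push_cast; ring
    rw [Complex.sub_re, Complex.add_re, this, Complex.ofReal_re]
    simp [pair, cbar]
  have h3 : absSq (z - g.z) = absSq z + absSq g.z - 2 * ∑ k, (conj (g.z k) * z k).re := by
    simp only [absSq_eq, Finset.mul_sum, ← Finset.sum_add_distrib, ← Finset.sum_sub_distrib]
    refine Finset.sum_congr rfl fun k _ => ?_
    simp
    ring
  rw [h2, h3]
  ring

theorem piFun_one (lam : ℝ) (χ : AddChar (Fin m → ℝ) Circle) (f : (Fin n → ℂ) → ℂ) :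
    piFun lam χ (1 : DGroup α) f = f := by
  funext z
  simp [piFun, pair, cbar, absSq, act_zero]

theorem absSq_eq_pair (z : Fin n → ℂ) : (absSq z : ℂ) = pair (cbar z) z := by
  simp [absSq, pair, cbar, Complex.conj_mul']

theorem pair_comm (z w : Fin n → ℂ) : pair z w = pair w z := by
  simp [pair, mul_comm]

theorem pair_add_left (x y z : Fin n → ℂ) : pair (x + y) z = pair x z + pair y z := by
  simp [pair, add_mul, Finset.sum_add_distrib]

theorem pair_sub_right (x y z : Fin n → ℂ) : pair x (y - z) = pair x y - pair x z := by
  simp [pair, mul_sub, Finset.sum_sub_distrib]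

theorem cbar_add (x y : Fin n → ℂ) : cbar (x + y) = cbar x + cbar y := by
  funext k
  simp [cbar]

theorem pair_cbar_act (t : Fin m → ℝ) (w z : Fin n → ℂ) :
    pair (cbar w) (act α (-t) z) = pair (cbar (act α t w)) z := by
  refine Finset.sum_congr rfl fun k _ => ?_
  simp only [cbar, act, map_mul, ← Complex.exp_conj, Complex.conj_I, Complex.conj_ofReal, map_neg,
    Complex.ofReal_neg]
  rw [neg_mul, mul_neg]
  ring

theorem piFun_mul (lam : ℝ) (χ : AddChar (Fin m → ℝ) Circle) (g h : DGroup α)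
    (f : (Fin n → ℂ) → ℂ) : piFun lam χ (g * h) f = piFun lam χ g (piFun lam χ h f) := by
  funext z
  have e1 : act α (-(g.t + h.t)) (z - (g.z + act α g.t h.z))
      = act α (-h.t) (act α (-g.t) (z - g.z) - h.z) := by
    rw [neg_add_rev, act_add, ← sub_sub, sub_eq_add_neg (z - g.z), act_vadd (-g.t), act_vneg,
      act_neg_self, ← sub_eq_add_neg]
  simp only [piFun, mul_t, mul_z, mul_c, e1, AddChar.map_add_eq_mul, Circle.coe_mul]
  have e2 : ∀ y : Fin n → ℂ,
      Complex.I * lam * ((g.c + h.c + 1 / 2 * omegaR g.z y : ℝ) : ℂ)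
        + lam / 2 * pair (cbar (g.z + y)) z - lam / 4 * absSq (g.z + y)
      = (Complex.I * lam * g.c + lam / 2 * pair (cbar g.z) z - lam / 4 * absSq g.z)
        + (Complex.I * lam * h.c + lam / 2 * pair (cbar y) (z - g.z) - lam / 4 * absSq y) := by
    intro y
    push_cast
    rw [omegaR_eq]
    simp only [omega, absSq_eq_pair, cbar_add, pair_add_left, pair_sub_right]
    rw [pair_comm _ (g.z + y), pair_comm _ (g.z + y), pair_add_left, pair_add_left,
      pair_comm g.z (cbar y), pair_comm y (cbar g.z), pair_comm g.z (cbar g.z),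
      pair_comm y (cbar y)]
    linear_combination (lam / 4 * (pair (cbar y) g.z - pair (cbar g.z) y)) * Complex.I_sq
  rw [e2, Complex.exp_add, pair_cbar_act, ← absSq_act (α := α) g.t h.z]
  ring

/-- The representation `π` of the generalized diamond group on the Fock space attached to `λ` and
to the unitary character `χ` of `ℝᵐ`. -/
def rep (α : Fin n → ((Fin m → ℝ) →ₗ[ℝ] ℝ)) (lam : ℝ) (χ : AddChar (Fin m → ℝ) Circle) :
    Representation ℂ (DGroup α) (Fock n lam) where
  toFun g :=
    { toFun := fun f => ⟨piFun lam χ g f, piFun_mem χ g f.2⟩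
      map_add' := fun f f' => by
        ext z
        simp [piFun, mul_add]
      map_smul' := fun a f => by
        ext z
        simp [piFun]
        ring }
  map_one' := by
    ext f z
    simp [piFun_one]
  map_mul' g h := by
    ext f z
    simp [piFun_mul]

/-! ### The complex Weyl symbol -/

/-- The kernel `k_A(z,w) = ⟨A e_w, e_z⟩` of an operator on the Fock space. -/
def kernel {lam : ℝ} (hlam : 0 < lam) (A : Fock n lam →ₗ[ℂ] Fock n lam) (z w : Fin n → ℂ) : ℂ :=
  fockInner (A (coh hlam w)) (coh hlam z)

/-- The integrand
`k_A(z+w, z-w) exp((λ/2)(-z z̄ - w w̄ + z w̄ - z̄ w))` of the complex Weyl symbol. -/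
def weylIntegrand {lam : ℝ} (hlam : 0 < lam) (A : Fock n lam →ₗ[ℂ] Fock n lam)
    (z w : Fin n → ℂ) : ℂ :=
  kernel hlam A (z + w) (z - w) * Complex.exp (lam / 2 *
    (-pair z (cbar z) - pair w (cbar w) + pair z (cbar w) - pair (cbar z) w))

/-- The complex Weyl symbol
`W₀(A)(z) = 2ⁿ ∫ k_A(z+w, z-w) exp((λ/2)(-z z̄ - w w̄ + z w̄ - z̄ w)) dμ_λ(w)`. -/
def weyl {lam : ℝ} (hlam : 0 < lam) (A : Fock n lam →ₗ[ℂ] Fock n lam) (z : Fin n → ℂ) : ℂ :=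
  2 ^ n * ∫ w, weylIntegrand hlam A z w ∂(fockMeasure n lam)

/-- `a ↦ tan(a/2) / a`, extended by its limit `1/2` at `a = 0`. -/
def tanQuot (a : ℝ) : ℝ := if a = 0 then 1 / 2 else Real.tan (a / 2) / a

/-- `a ↦ (a - 2 tan(a/2)) / a²`, extended by its limit `0` at `a = 0`. -/
def tanQuot₂ (a : ℝ) : ℝ := if a = 0 then 0 else (a - 2 * Real.tan (a / 2)) / a ^ 2

end Diamond

end

noncomputable section

open MeasureTheory
open scoped ComplexConjugate

namespace Diamond

/-! ### Gaussian integrals on `ℂⁿ` -/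

/-! Everything reduces to one Gaussian integral, `integral_cexp_complex_gaussian`: the integral of
exp(-b|w|² + pw + qw̄) over ℂ is (π/b) exp(pq/b) when Re b > 0, with p and q independent complex
numbers. On ℂⁿ with dμ_λ and λ/2 factored out of the exponent, `integral_cexp_fockMeasure` turns
this into ∏ βₖ⁻¹ · exp((λ/2) ∑ PₖQₖ/βₖ), the powers of λ and π cancelling.

The formula is applied twice. With βₖ = 1 it gives the kernel of π(g) (`kernel_rep`). Substituting
(z+w, z-w) makes the Weyl integrand a Gaussian in w again, with βₖ = 1 + e^{-iαₖ(t)}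
(`weylIntegrand_rep`). Here Re βₖ = 1 + cos αₖ(t), which is positive exactly because αₖ(t) avoids π
+ 2πℤ; hence absolute convergence and the product of the (1 + e^{-iαₖ(t)})⁻¹.

It remains to insert g = exp X and simplify the exponent. A one-parameter subgroup satisfies a
linear ODE, solved in closed form in `isOneParam_eq`. The exponent is then a sum over coordinates,
and `weyl_exponent` rewrites each summand in terms of the half angle αₖ(t)/2, where tangents appear.
-/

/-- Separates the real and imaginary variables, so that the planar integral is a product of two
one-dimensional ones. The `+ 0` is the constant term in the shape expected by
`integral_cexp_quadratic`. -/
theorem gaussian_exponent_re_im (b p q : ℂ) (x y : ℝ) :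
    -b * ((⟨x, y⟩ : ℂ) * conj (⟨x, y⟩ : ℂ)) + p * ⟨x, y⟩ + q * conj (⟨x, y⟩ : ℂ)
      = (-b * x ^ 2 + (p + q) * x + 0) + (-b * y ^ 2 + (p - q) * Complex.I * y + 0) := by
  have h : (⟨x, y⟩ : ℂ) = x + y * Complex.I := Complex.mk_eq_add_mul_I x y
  rw [h]
  simp only [map_add, map_mul, Complex.conj_ofReal, Complex.conj_I]
  linear_combination (b * y ^ 2) * Complex.I_sq

theorem integrable_cexp_complex_gaussian {b : ℂ} (hb : 0 < b.re) (p q : ℂ) :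
    Integrable (fun w : ℂ => Complex.exp (-b * (w * conj w) + p * w + q * conj w)) := by
  rw [← (Complex.volume_preserving_equiv_real_prod.symm).integrable_comp_emb
    Complex.measurableEquivRealProd.symm.measurableEmbedding]
  refine ((integrable_cexp_quadratic hb (p + q) 0).mul_prod
    (integrable_cexp_quadratic hb ((p - q) * Complex.I) 0)).congr (.of_forall fun v => ?_)
  simp only [Function.comp, Complex.measurableEquivRealProd_symm_apply, gaussian_exponent_re_im,
    Complex.exp_add]

theorem integral_cexp_complex_gaussian {b : ℂ} (hb : 0 < b.re) (p q : ℂ) :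
    ∫ w : ℂ, Complex.exp (-b * (w * conj w) + p * w + q * conj w)
      = Real.pi / b * Complex.exp (p * q / b) := by
  have hb0 : b ≠ 0 := by rintro rfl; simp at hb
  have hb' : (-b).re < 0 := by simpa using hb
  rw [← (Complex.volume_preserving_equiv_real_prod.symm).integral_comp
    Complex.measurableEquivRealProd.symm.measurableEmbedding]
  simp only [Complex.measurableEquivRealProd_symm_apply, gaussian_exponent_re_im]
  simp_rw [Complex.exp_add (-b * ((_ : ℝ) : ℂ) ^ 2 + (p + q) * _ + 0)]
  rw [Measure.volume_eq_prod, integral_prod_mul (fun x : ℝ => Complex.exp (-b * x ^ 2 + (p + q) * x + 0))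
    (fun y : ℝ => Complex.exp (-b * y ^ 2 + (p - q) * Complex.I * y + 0)),
    integral_cexp_quadratic hb', integral_cexp_quadratic hb', mul_mul_mul_comm, ← Complex.exp_add,
    neg_neg]
  -- Both one-dimensional integrals carry the same branch of the square root, so no choice of branch
  -- survives.
  have hroot : ((Real.pi / b : ℂ) ^ (1 / 2 : ℂ)) * ((Real.pi / b : ℂ) ^ (1 / 2 : ℂ))
      = Real.pi / b := by
    rw [← Complex.cpow_add _ _ (by simp [hb0, Real.pi_ne_zero])]
    norm_num
  rw [hroot]
  -- The exponents combine by (p+q)² - (p-q)² = 4pq.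
  congr 2
  field_simp
  linear_combination ((p - q) ^ 2) * Complex.I_sq

theorem half_mul_re_pos {lam : ℝ} (hlam : 0 < lam) {b : ℂ} (hb : 0 < b.re) :
    0 < ((lam / 2 : ℂ) * b).re := by
  have : ((lam / 2 : ℂ) * b).re = lam / 2 * b.re := by
    rw [← Complex.re_ofReal_mul]; push_cast; rfl
  rw [this]
  positivity

variable {n : ℕ}

theorem integrable_cexp_fockMeasure {lam : ℝ} (hlam : 0 < lam) {β : Fin n → ℂ}
    (hβ : ∀ k, 0 < (β k).re) (P Q : Fin n → ℂ) :
    Integrable (fun w : Fin n → ℂ => Complex.exp (lam / 2 *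
      ∑ k, (-β k * (w k * conj (w k)) + P k * w k + Q k * conj (w k)))) (fockMeasure n lam) := by
  refine Integrable.smul_measure ?_ ENNReal.ofReal_ne_top
  have hb : ∀ k, 0 < ((lam / 2 : ℂ) * β k).re := fun k => half_mul_re_pos hlam (hβ k)
  refine (Integrable.fintype_prod fun k => integrable_cexp_complex_gaussian (hb k)
    (lam / 2 * P k) (lam / 2 * Q k)).congr (.of_forall fun w => ?_)
  simp only
  rw [← Complex.exp_sum, Finset.mul_sum]
  congr 1
  refine Finset.sum_congr rfl fun k _ => ?_
  ring

theorem integral_cexp_fockMeasure {lam : ℝ} (hlam : 0 < lam) {β : Fin n → ℂ}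
    (hβ : ∀ k, 0 < (β k).re) (P Q : Fin n → ℂ) :
    ∫ w, Complex.exp (lam / 2 *
        ∑ k, (-β k * (w k * conj (w k)) + P k * w k + Q k * conj (w k))) ∂(fockMeasure n lam)
      = (∏ k, (β k)⁻¹) * Complex.exp (lam / 2 * ∑ k, P k * Q k / β k) := by
  have hl : (lam : ℂ) ≠ 0 := by exact_mod_cast hlam.ne'
  have hπ : (Real.pi : ℂ) ≠ 0 := by exact_mod_cast Real.pi_ne_zero
  have hb : ∀ k, 0 < ((lam / 2 : ℂ) * β k).re := fun k => half_mul_re_pos hlam (hβ k)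
  have hβ0 : ∀ k, β k ≠ 0 := fun k h => by simpa [h] using hβ k
  have e : ∀ w : Fin n → ℂ, Complex.exp (lam / 2 *
        ∑ k, (-β k * (w k * conj (w k)) + P k * w k + Q k * conj (w k)))
      = ∏ k, Complex.exp (-(lam / 2 * β k) * (w k * conj (w k)) + lam / 2 * P k * w k
        + lam / 2 * Q k * conj (w k)) := fun w => by
    rw [← Complex.exp_sum, Finset.mul_sum]
    congr 1
    refine Finset.sum_congr rfl fun k _ => ?_
    ring
  simp_rw [e]
  rw [fockMeasure, integral_smul_measure, integral_fintype_prod_volume_eq_prod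
    (f := fun k (w : ℂ) => Complex.exp (-(lam / 2 * β k) * (w * conj w) + lam / 2 * P k * w
        + lam / 2 * Q k * conj w))]
  simp_rw [integral_cexp_complex_gaussian (hb _)]
  rw [ENNReal.toReal_ofReal (by positivity), Finset.mul_sum, Complex.exp_sum, ← mul_pow]
  -- One factor λ/2π per coordinate, to cancel against π/((λ/2)βₖ) and leave βₖ⁻¹.
  have hc : ((2 * Real.pi)⁻¹ * lam) ^ n = ∏ _k : Fin n, ((2 * Real.pi)⁻¹ * lam) := by simp
  rw [hc, Complex.real_smul, Complex.ofReal_prod, ← Finset.prod_mul_distrib,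
    ← Finset.prod_mul_distrib]
  refine Finset.prod_congr rfl fun k _ => ?_
  have := hβ0 k
  rw [← mul_assoc]
  congr 1
  · push_cast
    field_simp
  · congr 1
    field_simp

/-! ### The exponential map in coordinates -/

/-- `(e^{ias} - 1) / (ia)`, extended by `s` at `a = 0`. -/
def expCoord (a s : ℝ) : ℂ :=
  if a = 0 then (s : ℂ) else (Complex.exp (Complex.I * a * s) - 1) / (Complex.I * a)

/-- `(as - sin (as)) / (2a²)`, extended by `0` at `a = 0`. -/
def expCentral (a s : ℝ) : ℝ :=
  if a = 0 then 0 else (a * s - Real.sin (a * s)) / (2 * a ^ 2)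

theorem expCoord_zero (a : ℝ) : expCoord a 0 = 0 := by simp [expCoord]

theorem expCentral_zero (a : ℝ) : expCentral a 0 = 0 := by simp [expCentral]

theorem expCoord_im (a s : ℝ) :
    (expCoord a s).im = if a = 0 then 0 else (1 - Real.cos (a * s)) / a := by
  by_cases ha : a = 0
  · simp [expCoord, ha]
  · have ha' : (a : ℂ) ≠ 0 := by exact_mod_cast ha
    have h : expCoord a s = (⟨Real.sin (a * s) / a, (1 - Real.cos (a * s)) / a⟩ : ℂ) := by
      have e : Complex.I * a * s = ((a * s : ℝ) : ℂ) * Complex.I := by push_cast; ring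
      rw [expCoord, if_neg ha, div_eq_iff (by simp [ha']), e, Complex.exp_mul_I,
        ← Complex.ofReal_cos, ← Complex.ofReal_sin]
      refine Complex.ext ?_ ?_ <;>
        simp [-Complex.ofReal_cos, -Complex.ofReal_sin, -Complex.ofReal_mul] <;>
        field_simp <;> ring
    rw [h, if_neg ha]

/-- This is the equation ζ' = 1 + iaζ; multiplied by uₖ with a = αₖ(t), it is the ODE of the
zₖ-coordinate in `isOneParam_deriv`. -/
theorem hasDerivAt_expCoord (a s : ℝ) :
    HasDerivAt (expCoord a) (1 + Complex.I * a * expCoord a s) s := by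
  have hid : HasDerivAt (fun r : ℝ => (r : ℂ)) 1 s := Complex.ofRealCLM.hasDerivAt (x := s)
  by_cases ha : a = 0
  · have : expCoord a = fun r : ℝ => (r : ℂ) := by funext r; simp [expCoord, ha]
    rw [this]
    simpa [ha] using hid
  · have ha' : (a : ℂ) ≠ 0 := by exact_mod_cast ha
    have e : expCoord a =
        fun r : ℝ => (Complex.exp (Complex.I * a * r) - 1) / (Complex.I * a) := by
      funext r; simp [expCoord, ha]
    rw [e]
    refine (((hid.const_mul (Complex.I * a)).cexp.sub_const 1).div_const
      (Complex.I * a)).congr_deriv ?_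
    have hI := Complex.I_ne_zero
    field_simp
    ring

/-- Matches the central ODE of `isOneParam_deriv`: for z = ζu one has ω(u, ζu) = |u|² Im ζ in each
coordinate. -/
theorem hasDerivAt_expCentral (a s : ℝ) :
    HasDerivAt (expCentral a) (1 / 2 * (expCoord a s).im) s := by
  rw [expCoord_im]
  by_cases ha : a = 0
  · have : expCentral a = fun _ => 0 := by funext r; simp [expCentral, ha]
    rw [this]
    simpa [ha] using hasDerivAt_const s (0 : ℝ)
  · have e : expCentral a = fun r => (a * r - Real.sin (a * r)) / (2 * a ^ 2) := by
      funext r; simp [expCentral, ha]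
    have h0 := (hasDerivAt_id s).const_mul a
    rw [e, if_neg ha]
    refine ((h0.fun_sub h0.sin).div_const (2 * a ^ 2)).congr_deriv ?_
    simp only [id]
    field_simp

variable {m : ℕ} {α : Fin n → ((Fin m → ℝ) →ₗ[ℝ] ℝ)}

theorem eq_zero_of_hasDerivAt_zero {E : Type*} [NormedAddCommGroup E] [NormedSpace ℝ E]
    {f : ℝ → E} (hf : ∀ s, HasDerivAt f 0 s) (h0 : f 0 = 0) (s : ℝ) : f s = 0 := by
  rw [is_const_of_deriv_eq_zero (fun s => (hf s).differentiableAt) (fun s => (hf s).deriv) s 0, h0]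

theorem isOneParam_eq {γ : ℝ → DGroup α} {t : Fin m → ℝ} {u : Fin n → ℂ} {c : ℝ}
    (h : IsOneParam γ (t, u, c)) (s : ℝ) :
    γ s = ⟨s • t, fun k => expCoord (α k t) s * u k,
      s * c + ∑ k, ‖u k‖ ^ 2 * expCentral (α k t) s⟩ := by
  have h0 := isOneParam_zero h
  have hz : ∀ s, (γ s).z = fun k => expCoord (α k t) s * u k := fun s => by
    funext k
    -- The difference of two solutions satisfies y' = iαₖ(t)y, so the integrating factor
    -- e^{-iαₖ(t)s} makes it constant.
    have h1 := eq_zero_of_hasDerivAt_zero (f := fun s : ℝ =>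
      Complex.exp (-(Complex.I * (α k t : ℂ) * (s : ℂ))) *
        ((γ s).z k - expCoord (α k t) s * u k)) (fun s => by
        have h2 := (((Complex.ofRealCLM.hasDerivAt (x := s)).const_mul
          (Complex.I * (α k t : ℂ))).fun_neg.cexp).fun_mul
          (((isOneParam_deriv h s).2.1 k).fun_sub
            ((hasDerivAt_expCoord (α k t) s).mul_const (u k)))
        refine h2.congr_deriv ?_
        simp
        ring) (by simp [h0, expCoord_zero]) s
    simpa [sub_eq_zero] using h1
  ext1
  · have h1 := eq_zero_of_hasDerivAt_zero (f := fun s => (γ s).t - s • t)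
      (fun s => by
        simpa using (isOneParam_deriv h s).1.fun_sub ((hasDerivAt_id s).smul_const t))
      (by simp [h0]) s
    exact sub_eq_zero.1 h1
  · exact hz s
  · have h1 := eq_zero_of_hasDerivAt_zero
      (f := fun s => (γ s).c - (s * c + ∑ k, ‖u k‖ ^ 2 * expCentral (α k t) s))
      (fun s => by
        have h2 := (isOneParam_deriv h s).2.2.fun_sub
          (((hasDerivAt_id s).mul_const c).fun_add
            (HasDerivAt.fun_sum (u := Finset.univ) fun k _ =>
              (hasDerivAt_expCentral (α k t) s).const_mul (‖u k‖ ^ 2)))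
        refine h2.congr_deriv ?_
        rw [hz, omegaR_sum, one_mul, add_sub_add_left_eq_sub, sub_eq_zero, Finset.mul_sum]
        refine Finset.sum_congr rfl fun k _ => ?_
        rw [← Complex.normSq_eq_norm_sq, Complex.normSq_apply]
        simp only [Complex.mul_re, Complex.mul_im]
        ring)
      (by simp [h0, expCentral_zero]) s
    exact sub_eq_zero.1 h1

theorem expG_eq (t : Fin m → ℝ) (u : Fin n → ℂ) (c : ℝ) :
    expG α (t, u, c) = ⟨t, fun k => expCoord (α k t) 1 * u k,
      c + ∑ k, ‖u k‖ ^ 2 * expCentral (α k t) 1⟩ := by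
  have h := isOneParam_eq (existsUnique_isOneParam α (t, u, c)).choose_spec.1 1
  rw [one_smul, one_mul] at h
  exact h

/-! ### The kernel of `π(g)` and its Weyl integrand -/

/-- The value is (π(g)e_w)(z), as the reproducing property predicts; here it comes directly from the
Gaussian formula with β = 1, where conj e_z supplies the coefficient Q = z. -/
theorem kernel_rep {lam : ℝ} (hlam : 0 < lam) (χ : AddChar (Fin m → ℝ) Circle) (g : DGroup α)
    (z w : Fin n → ℂ) :
    kernel hlam (rep α lam χ g) z w = (χ g.t : ℂ) * Complex.exp (Complex.I * lam * g.c) *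
      Complex.exp (lam / 2 * ∑ k, (conj (g.z k) * z k - g.z k * conj (g.z k) / 2 +
        Complex.exp (-(Complex.I * (α k g.t : ℂ))) * conj (w k) * (z k - g.z k))) := by
  have hE : ∀ v : Fin n → ℂ, piFun lam χ g (cohFun lam w) v * conj (cohFun lam z v) *
      (Real.exp (-lam * absSq v / 2) : ℂ) = (χ g.t : ℂ) * Complex.exp (Complex.I * lam * g.c) *
      Complex.exp (lam / 2 * ∑ k, (-(g.z k * conj (g.z k) / 2) -
        Complex.exp (-(Complex.I * (α k g.t : ℂ))) * conj (w k) * g.z k)) *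
      Complex.exp (lam / 2 * ∑ k, (-(1 : ℂ) * (v k * conj (v k)) +
        (conj (g.z k) + Complex.exp (-(Complex.I * (α k g.t : ℂ))) * conj (w k)) * v k +
        z k * conj (v k))) := by
    intro v
    simp only [piFun, cohFun, ← Complex.exp_conj, Complex.ofReal_exp, mul_assoc, ← Complex.exp_add]
    congr 2
    push_cast
    simp only [absSq_eq_pair, pair, cbar, act, map_mul, map_div₀, map_sum, Complex.conj_ofReal,
      Complex.conj_conj, map_neg, Complex.ofReal_neg, map_ofNat, Finset.mul_sum, Finset.sum_div,
      Pi.sub_apply, mul_neg]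
    simp only [add_assoc, sub_eq_add_neg, ← Finset.sum_neg_distrib, ← Finset.sum_add_distrib]
    congr 1
    refine Finset.sum_congr rfl fun k _ => ?_
    ring
  change ∫ v, piFun lam χ g (cohFun lam w) v * conj (cohFun lam z v) *
    (Real.exp (-lam * absSq v / 2) : ℂ) ∂(fockMeasure n lam) = _
  simp_rw [hE]
  rw [integral_const_mul, integral_cexp_fockMeasure hlam (β := fun _ => 1) (by simp)]
  rw [Finset.prod_eq_one (by simp), one_mul, mul_assoc, ← Complex.exp_add, ← mul_add,
    ← Finset.sum_add_distrib]
  congr 3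
  refine Finset.sum_congr rfl fun k _ => ?_
  ring

/-- Sorted by powers of w and w̄: the kernel contributes -e^{-iαₖ}|wₖ|² and the Weyl factor -|wₖ|²,
which together give β = 1 + e^{-iαₖ}. -/
theorem weylIntegrand_rep {lam : ℝ} (hlam : 0 < lam) (χ : AddChar (Fin m → ℝ) Circle)
    (g : DGroup α) (z w : Fin n → ℂ) :
    weylIntegrand hlam (rep α lam χ g) z w =
      (χ g.t : ℂ) * Complex.exp (Complex.I * lam * g.c) *
      Complex.exp (lam / 2 * ∑ k, (conj (g.z k) * z k - g.z k * conj (g.z k) / 2 +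
        Complex.exp (-(Complex.I * (α k g.t : ℂ))) * conj (z k) * (z k - g.z k)
        - z k * conj (z k))) *
      Complex.exp (lam / 2 * ∑ k, (
        -(1 + Complex.exp (-(Complex.I * (α k g.t : ℂ)))) * (w k * conj (w k)) +
        (conj (g.z k) - (1 - Complex.exp (-(Complex.I * (α k g.t : ℂ)))) * conj (z k)) * w k +
        (Complex.exp (-(Complex.I * (α k g.t : ℂ))) * g.z k +
          (1 - Complex.exp (-(Complex.I * (α k g.t : ℂ)))) * z k) * conj (w k))) := by
  rw [weylIntegrand, kernel_rep]
  simp only [mul_assoc (_ * Complex.exp (Complex.I * lam * g.c)), ← Complex.exp_add, ← mul_add]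
  congr 3
  simp only [pair, cbar, Pi.add_apply, Pi.sub_apply, sub_eq_add_neg,
    ← Finset.sum_neg_distrib, ← Finset.sum_add_distrib]
  refine Finset.sum_congr rfl fun k _ => ?_
  simp only [map_add, map_neg]
  ring

/-! ### Half-angle trigonometry in one coordinate -/

theorem one_add_exp_re_pos {a : ℝ} (ha : ∀ l : ℤ, a ≠ Real.pi + 2 * Real.pi * l) :
    0 < (1 + Complex.exp (-(Complex.I * (a : ℂ)))).re := by
  have e : -(Complex.I * (a : ℂ)) = ((-a : ℝ) : ℂ) * Complex.I := by push_cast; ring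
  rw [Complex.add_re, Complex.one_re, e, Complex.exp_ofReal_mul_I_re, Real.cos_neg]
  have h1 : Real.cos a ≠ -1 := fun h => by
    obtain ⟨l, hl⟩ := Real.cos_eq_neg_one_iff.1 h
    exact ha l (by rw [← hl]; ring)
  have := lt_of_le_of_ne (Real.neg_one_le_cos a) h1.symm
  linarith

theorem cos_half_ne_zero {a : ℝ} (ha : ∀ l : ℤ, a ≠ Real.pi + 2 * Real.pi * l) :
    Real.cos (a / 2) ≠ 0 := fun h => by
  obtain ⟨l, hl⟩ := Real.cos_eq_zero_iff.1 h
  exact ha l (by linarith)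

/-- The exponent contributed by one coordinate to the Weyl symbol of `π(exp X)`. -/
theorem weyl_exponent {a : ℝ} (ha : ∀ l : ℤ, a ≠ Real.pi + 2 * Real.pi * l) (u z : ℂ) :
    2 * Complex.I * ((‖u‖ : ℂ) ^ 2 * (expCentral a 1 : ℂ)) +
      ((conj (expCoord a 1 * u) * z - expCoord a 1 * u * conj (expCoord a 1 * u) / 2 +
        Complex.exp (-(Complex.I * (a : ℂ))) * conj z * (z - expCoord a 1 * u) - z * conj z) +
      (conj (expCoord a 1 * u) - (1 - Complex.exp (-(Complex.I * (a : ℂ)))) * conj z) *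
        (Complex.exp (-(Complex.I * (a : ℂ))) * (expCoord a 1 * u) +
          (1 - Complex.exp (-(Complex.I * (a : ℂ)))) * z) /
        (1 + Complex.exp (-(Complex.I * (a : ℂ)))))
    = Complex.I * ((‖u‖ : ℂ) ^ 2 * (tanQuot₂ a : ℂ)) -
      2 * Complex.I * ((‖z‖ : ℂ) ^ 2 * (Real.tan (a / 2) : ℂ)) +
      2 * ((tanQuot a : ℂ) * (z * conj u - conj z * u)) := by
  rw [← Complex.mul_conj', ← Complex.mul_conj']
  by_cases h0 : a = 0
  · subst h0
    simp [expCoord, expCentral, tanQuot, tanQuot₂]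
    ring
  have h0' : (a : ℂ) ≠ 0 := by exact_mod_cast h0
  set C : ℂ := (Real.cos (a / 2) : ℂ) with hC
  set S : ℂ := (Real.sin (a / 2) : ℂ) with hS
  have hC0 : C ≠ 0 := Complex.ofReal_ne_zero.2 (cos_half_ne_zero ha)
  have hSC : S ^ 2 + C ^ 2 = 1 := by
    rw [hC, hS]; exact_mod_cast Real.sin_sq_add_cos_sq (a / 2)
  have hI := Complex.I_sq
  have hhalf : Complex.exp (a / 2 * Complex.I) = C + S * Complex.I := by
    rw [Complex.exp_mul_I, hC, hS]; push_cast; rfl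
  have hhalf' : Complex.exp (-(a / 2) * Complex.I) = C - S * Complex.I := by
    rw [Complex.exp_mul_I, Complex.cos_neg, Complex.sin_neg, hC, hS]; push_cast; ring
  have hexp : Complex.exp (Complex.I * a) = (C + S * Complex.I) ^ 2 := by
    rw [← hhalf, ← Complex.exp_nat_mul]; congr 1; push_cast; ring
  have hexp' : Complex.exp (-(Complex.I * a)) = (C - S * Complex.I) ^ 2 := by
    rw [← hhalf', ← Complex.exp_nat_mul]; congr 1; push_cast; ring
  -- That is, 1 + e^{-ia} = 2 cos(a/2) e^{-ia/2} and 1 - e^{-ia} = 2i sin(a/2) e^{-ia/2}; their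
  -- quotient produces i tan(a/2).
  have hd : 1 + (C - S * Complex.I) ^ 2 = 2 * C * (C - S * Complex.I) := by
    linear_combination (-1) * hSC + S ^ 2 * hI
  have hd' : 1 - (C - S * Complex.I) ^ 2 = 2 * Complex.I * S * (C - S * Complex.I) := by
    linear_combination (-1) * hSC + S ^ 2 * hI
  have hM : (C + S * Complex.I) * (C - S * Complex.I) = 1 := by
    linear_combination hSC - S ^ 2 * hI
  have hz : expCoord a 1 = 2 * S * (C + S * Complex.I) / a := by
    rw [expCoord, if_neg h0, Complex.ofReal_one, mul_one, hexp]
    field_simp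
    linear_combination hSC - S ^ 2 * hI
  have hzc : conj (expCoord a 1) = 2 * S * (C - S * Complex.I) / a := by
    simp [hz, hC, hS, sub_eq_add_neg, -Complex.ofReal_cos, -Complex.ofReal_sin, map_ofNat]
  have hc : (expCentral a 1 : ℂ) = (a - 2 * S * C) / (2 * a ^ 2) := by
    have : Real.sin a = 2 * Real.sin (a / 2) * Real.cos (a / 2) := by
      rw [← Real.sin_two_mul]; congr 1; ring
    rw [expCentral, if_neg h0, mul_one, this, hC, hS]; push_cast; ring
  have ht : (Real.tan (a / 2) : ℂ) = S / C := by rw [Real.tan_eq_sin_div_cos, hC, hS]; push_cast; rfl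
  have ht1 : (tanQuot a : ℂ) = S / C / a := by
    rw [tanQuot, if_neg h0, Complex.ofReal_div, ht]
  have ht2 : (tanQuot₂ a : ℂ) = (a - 2 * (S / C)) / a ^ 2 := by
    rw [tanQuot₂, if_neg h0, ← ht]; push_cast; ring
  rw [map_mul, hzc, hz, hc, ht, ht1, ht2, hexp', hd, hd']
  -- All trigonometry is now in S² + C² = 1 and J² = -1. With u, ū, z, z̄ as independent variables,
  -- the claim is an identity of rational functions modulo these two relations.
  clear_value C S
  have hM0 : C - S * Complex.I ≠ 0 := fun h => by simp [h] at hM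
  generalize conj u = u'
  generalize conj z = z'
  generalize (a : ℂ) = A at *
  generalize Complex.I = J at *
  clear hhalf hhalf' hexp hexp' hz hzc hc ht ht1 ht2 hC hS ha h0
  field_simp
  grind

end Diamond

end

/-! ### The Weyl symbol of π(exp X) -/

theorem mainTheorem10 {m n : ℕ} (α : Fin n → ((Fin m → ℝ) →ₗ[ℝ] ℝ)) {lam : ℝ} (hlam : 0 < lam)
    (χ : AddChar (Fin m → ℝ) Circle) (t : Fin m → ℝ) (u : Fin n → ℂ) (c : ℝ)
    (ht : ∀ (k : Fin n) (l : ℤ), α k t ≠ Real.pi + 2 * Real.pi * l) (z : Fin n → ℂ) :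
    MeasureTheory.Integrable
        (Diamond.weylIntegrand hlam (Diamond.rep α lam χ (Diamond.expG α (t, u, c))) z) (Diamond.fockMeasure n lam) ∧
      Diamond.weyl hlam (Diamond.rep α lam χ (Diamond.expG α (t, u, c))) z =
        2 ^ n * (χ t : ℂ) * Complex.exp (Complex.I * lam * c)
          * (∏ k, (1 + Complex.exp (-(Complex.I * (α k t : ℂ))))⁻¹)
          * Complex.exp (Complex.I * (lam / 2) *
              ∑ k, (‖u k‖ : ℂ) ^ 2 * (Diamond.tanQuot₂ (α k t) : ℂ))
          * Complex.exp (-(Complex.I * lam *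
              ∑ k, (‖z k‖ : ℂ) ^ 2 * (Real.tan (α k t / 2) : ℂ)))
          * Complex.exp (lam *
              ∑ k, (Diamond.tanQuot (α k t) : ℂ) * (z k * (starRingEnd ℂ) (u k)
                - (starRingEnd ℂ) (z k) * u k)) := by
  have hre := fun k => Diamond.one_add_exp_re_pos (ht k)
  have hint : ∀ w, Diamond.weylIntegrand hlam (Diamond.rep α lam χ (Diamond.expG α (t, u, c))) z w
      = _ := Diamond.weylIntegrand_rep hlam χ (Diamond.expG α (t, u, c)) z
  simp only [Diamond.expG_eq] at hint
  rw [Diamond.expG_eq]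
  refine ⟨?_, ?_⟩
  · refine ((Diamond.integrable_cexp_fockMeasure hlam hre _ _).const_mul _).congr
      (.of_forall fun w => (hint w).symm)
  · rw [Diamond.weyl]
    simp_rw [hint]
    rw [MeasureTheory.integral_const_mul, Diamond.integral_cexp_fockMeasure hlam hre]
    have hsum := Finset.sum_congr rfl fun k (_ : k ∈ Finset.univ) =>
      Diamond.weyl_exponent (ht k) (u k) (z k)
    simp only [Finset.sum_add_distrib, Finset.sum_sub_distrib, ← Finset.mul_sum] at hsum
    -- Sets aside 2ⁿ, χ(t) and the product of the βₖ⁻¹, so that only exponents are left to compare.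
    have hexp : ∀ A B C D E F H : ℂ, Complex.exp A * Complex.exp B * Complex.exp C =
        Complex.exp D * Complex.exp E * Complex.exp F * Complex.exp H →
        ∀ x p : ℂ, 2 ^ n * (x * Complex.exp A * Complex.exp B * (p * Complex.exp C)) =
          2 ^ n * x * Complex.exp D * p * Complex.exp E * Complex.exp F * Complex.exp H := by
      intro A B C D E F H h x p
      linear_combination (2 ^ n * x * p) * h
    refine hexp _ _ _ _ _ _ _ ?_ _ _
    simp only [← Complex.exp_add]
    congr 1
    push_cast [-Complex.ofReal_tan]
    simp only [Finset.sum_add_distrib, Finset.sum_sub_distrib]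
    -- The central term iλ∑|uₖ|²κₖ, with κₖ = `expCentral (α k t) 1`, equals (λ/2)·2i∑|uₖ|²κₖ, which
    -- explains the 2i in `weyl_exponent`.
    linear_combination (lam / 2 : ℂ) * hsum
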